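/- **The zigzag graph.** Its vertices are an empty zigzag $\varnothing$ and the zigzags, encoded by finite words in the symbols $+,-$; a zigzag with $n\ge 1$ boxes has a word of length $n-1$ (reading left to right, $+$ adds a box to the right and $-$ adds a box below). There is an edge from $\varnothing$ to the one-box zigzag, and an edge from $\lambda$ to $\mu$ whenever the word of $\lambda$ is obtained from the word of $\mu$ by deleting one symbol. Write $\lambda\le\mu$ if there is a (possibly trivial) upward path from $\lambda$ to $\mu$. **Templates.** A template is a finite sequence of alternating clusters, a cluster being a sign with a multiplicity in $\{1,2,\dots\}\cup\{\infty\}$, at least one multiplicity being infinite. For a template $t$ let $t^{(N)}$ be the zigzag whose word is obtained from $t$ by writing out all finite clusters and replacing every infinite cluster by a block of length $N$. The coideal of $t$ is $\mathbb Z(t)=\{\lambda : \lambda\le t^{(N)}\text{ for some }N\}$; equivalently, it is the set of all vertices lying weakly below some vertex of $\tau$, for any infinite path $\tau$ starting at $\varnothing$ that passes through $t^{(N)}$ for all large $N$. **Oriented paintboxes.** Let $W$ be the set of pairs $w=(w_+,w_-)$ of disjoint open subsets of $(0,1)$. Such a $w$ is a finitary oriented paintbox if $w_+$ and $w_-$ each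 have finitely many interval components and their total Lebesgue measure is $1$. In that case $t_w$ denotes the template obtained by listing the intervals from left to right, replacing each component of $w_+$ by an infinite cluster $+$ and each component of $w_-$ by an infinite cluster $-$, and inserting between any two neighboring infinite clusters of the same sign a one-symbol cluster of the opposite sign. **The function $\varphi_w$.** For $w\in W$ let $\varphi_w$ be the finite indecomposable harmonic function on the zigzag graph attached to $w$ by the oriented paintbox construction: $\varphi_w(\varnothing)=1$, and for a zigzag $\lambda$ with $n\ge1$ boxes $\varphi_w(\lambda)=\mathbb P(\Pi_n=\pi)$, where $\pi\in S_n$ is any permutation such that, for $1\le i<n$, $\pi(i)<\pi(i+1)$ if the $i$-th symbol of the word of $\lambda$ is $+$ and $\pi(i)>\pi(i+1)$ if it is $-$. The random permutation $\Pi_n$, in one-line notation, is the list of the labels $1,\dots,n$ of independent uniform random points $X_1,\dots,X_n$ of $(0,1)$, ordered as the points are from left to right, except that labels whose points lie in one component of $w_+$ are listed in increasing order and labels whose points lie in one component of $w_-$ are listed in decreasing order. (If $w$ is a finitary oriented paintbox with intervals of lengths $w_1,\dots,w_m$ from left to right, this is Kerov's construction: $\varphi_w(\lambda)=\sum w_1^{|\lambda(1)|}\cdots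 w_m^{|\lambda(m)|}$ over all splittings of $\lambda$ into $m$ consecutive, possibly empty, pieces $\lambda(1),\dots,\lambda(m)$, where $\lambda(i)$ is a row if the $i$-th interval lies in $w_+$ and a column if it lies in $w_-$.) **Proposition.** Let $w\in W$. If $w$ is a finitary oriented paintbox, then the support $\{\lambda : \varphi_w(\lambda)>0\}$ is the coideal $\mathbb Z(t_w)$. Otherwise $\varphi_w(\lambda)>0$ for every vertex $\lambda$ of the zigzag graph. -/

import Mathlib

open MeasureTheory
open scoped ENNReal

noncomputable section

namespace ZigzagGraph

/-! ### The zigzag graph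

A sign is a Boolean: `true` stands for `+` and `false` for `-`. -/

/-- A vertex of the zigzag graph: the empty zigzag, or the nonempty zigzag with binary word `a`,
which consists of `a.length + 1` boxes. -/
inductive Zigzag where
  | empty : Zigzag
  | ofWord (a : List Bool) : Zigzag

/-- The edges: the empty zigzag is joined to the one-box zigzag, and the zigzag of `a` is joined to
the zigzag of `b` when `a` is obtained from `b` by deleting a single symbol. -/
inductive Zigzag.Edge : Zigzag → Zigzag → Prop
  | box : Zigzag.Edge .empty (.ofWord [])
  | delete (b : List Bool) (i : Fin b.length) : Zigzag.Edge (.ofWord (b.eraseIdx i)) (.ofWord b)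

/-- `Below x y`: there is a (possibly trivial) path of edges going up from `x` to `y`. -/
def Zigzag.Below : Zigzag → Zigzag → Prop := Relation.ReflTransGen Zigzag.Edge

/-- Infinite paths in the zigzag graph starting at the empty zigzag. -/
def IsPath (τ : ℕ → Zigzag) : Prop := τ 0 = .empty ∧ ∀ n, (τ n).Edge (τ (n + 1))

/-- The coideal of all vertices that lie weakly below some vertex of the path. -/
def pathCoideal (τ : ℕ → Zigzag) : Set Zigzag := {x | ∃ n, x.Below (τ n)}

/-- The support of a function on the zigzag graph. -/
def support (φ : Zigzag → ℝ≥0∞) : Set Zigzag := {x | 0 < φ x}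

/-! ### Templates -/

/-- A template: a finite ordered collection of alternating clusters (a sign with a positive,
possibly infinite multiplicity), at least one of which is infinite. -/
structure Template where
  clusters : List (Bool × ℕ∞)
  multiplicity_ne_zero : ∀ c ∈ clusters, c.2 ≠ 0
  alternating : clusters.IsChain fun c d => c.1 ≠ d.1
  exists_infinite : ∃ c ∈ clusters, c.2 = ⊤

/-- The word in which every finite cluster is written out and every infinite cluster is replaced by
a block of length `N`. -/
def clusterWord (l : List (Bool × ℕ∞)) (N : ℕ) : List Bool :=
  l.flatMap fun c => List.replicate (if c.2 = ⊤ then N else c.2.toNat) c.1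

/-- The word of the template `t` with its infinite clusters replaced by blocks of length `N`. -/
def Template.word (t : Template) (N : ℕ) : List Bool := clusterWord t.clusters N

/-- The path goes through all zigzags obtained from `t` by replacing the infinite clusters with
long enough blocks. -/
def Template.FilledBy (t : Template) (τ : ℕ → Zigzag) : Prop :=
  ∃ N₀, ∀ N, N₀ ≤ N → ∃ n, τ n = .ofWord (t.word N)

/-- The coideal of a template. It is the coideal of every path that fills the template, and such
paths exist: see `Template.pathCoideal_eq` and `Template.exists_path`. -/
def Template.coideal (t : Template) : Set Zigzag := {x | ∃ N, x.Below (.ofWord (t.word N))}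

theorem Zigzag.below_of_sublist {a b : List Bool} (h : a.Sublist b) :
    (Zigzag.ofWord a).Below (.ofWord b) := by
  induction h with
  | slnil => exact .refl
  | @cons l₁ l₂ c _ ih => exact ih.tail (Zigzag.Edge.delete (c :: l₂) ⟨0, by simp⟩)
  | @cons_cons l₁ l₂ c _ ih =>
    have key : ∀ y, Relation.ReflTransGen Zigzag.Edge (.ofWord l₁) y → ∀ b', y = .ofWord b' →
        Relation.ReflTransGen Zigzag.Edge (.ofWord (c :: l₁)) (.ofWord (c :: b')) := by
      intro y hy
      induction hy with
      | refl => rintro b' h; cases h; exact .refl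
      | @tail y z h1 h2 ih2 =>
        rintro b' rfl
        generalize hz : Zigzag.ofWord b' = z at h2
        cases h2 with
        | box =>
          exfalso
          rcases Relation.ReflTransGen.cases_tail h1 with h | ⟨_, _, h⟩
          · cases h
          · cases h
        | delete b i =>
          cases hz
          exact (ih2 _ rfl).tail (Zigzag.Edge.delete (c :: b') ⟨i + 1, by simp⟩)
    exact key _ ih _ rfl

theorem Zigzag.empty_below (a : List Bool) : Zigzag.empty.Below (.ofWord a) :=
  (Relation.ReflTransGen.single Zigzag.Edge.box).trans
    (Zigzag.below_of_sublist (List.nil_sublist a))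

theorem Template.word_sublist (t : Template) {M N : ℕ} (h : M ≤ N) :
    (t.word M).Sublist (t.word N) := by
  unfold Template.word clusterWord
  induction t.clusters with
  | nil => simp
  | cons c l ih =>
    simp only [List.flatMap_cons]
    refine List.Sublist.append ?_ ih
    rw [List.replicate_sublist_replicate]
    split_ifs <;> simp [h]

theorem Template.le_length_word (t : Template) (N : ℕ) : N ≤ (t.word N).length := by
  obtain ⟨c, hc, htop⟩ := t.exists_infinite
  have : (List.replicate N c.1).Sublist (t.word N) := by
    have h := List.sublist_flatten_of_mem
      (List.mem_map_of_mem
        (f := fun c : Bool × ℕ∞ => List.replicate (if c.2 = ⊤ then N else c.2.toNat) c.1) hc)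
    simpa [Template.word, clusterWord, List.flatMap_def, htop] using h
  simpa using this.length_le

/-- The number of boxes. -/
def Zigzag.size : Zigzag → ℕ
  | .empty => 0
  | .ofWord a => a.length + 1

theorem Zigzag.Edge.size_eq {x y : Zigzag} (h : x.Edge y) : y.size = x.size + 1 := by
  cases h with
  | box => rfl
  | delete b i =>
    have := i.2
    simp only [Zigzag.size, List.length_eraseIdx, i.2, if_true]
    omega

theorem IsPath.size_eq {τ : ℕ → Zigzag} (h : IsPath τ) (n : ℕ) : (τ n).size = n := by
  induction n with
  | zero => rw [h.1]; rfl
  | succ n ih => rw [(h.2 n).size_eq, ih]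

theorem IsPath.below {τ : ℕ → Zigzag} (h : IsPath τ) {m n : ℕ} (hmn : m ≤ n) :
    (τ m).Below (τ n) := by
  induction n, hmn using Nat.le_induction with
  | base => exact .refl
  | succ n _ ih => exact ih.tail (h.2 n)

theorem Template.pathCoideal_eq (t : Template) {τ : ℕ → Zigzag} (hτ : IsPath τ)
    (h : t.FilledBy τ) : pathCoideal τ = t.coideal := by
  obtain ⟨N₀, h⟩ := h
  ext x
  constructor
  · rintro ⟨n, hn⟩
    obtain ⟨m, hm⟩ := h (max N₀ n) (le_max_left _ _)
    refine ⟨max N₀ n, ?_⟩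
    rw [← hm]
    refine hn.trans (hτ.below ?_)
    have h1 := hτ.size_eq m
    have h2 := t.le_length_word (max N₀ n)
    rw [hm, Zigzag.size] at h1
    have := le_max_right N₀ n
    omega
  · rintro ⟨N, hN⟩
    obtain ⟨m, hm⟩ := h (max N₀ N) (le_max_left _ _)
    refine ⟨m, hm ▸ hN.trans (Zigzag.below_of_sublist (t.word_sublist (le_max_right _ _)))⟩

theorem Zigzag.exists_saturated {x y : Zigzag} (h : x.Below y) :
    ∃ f : ℕ → Zigzag, f x.size = x ∧ f y.size = y ∧ x.size ≤ y.size ∧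
      ∀ n, x.size ≤ n → n < y.size → (f n).Edge (f (n + 1)) := by
  induction h with
  | refl => exact ⟨fun _ => x, rfl, rfl, le_rfl, fun n h1 h2 => absurd h1 (by omega)⟩
  | @tail y z _ hyz ih =>
    obtain ⟨f, h1, h2, h3, h4⟩ := ih
    have hs := hyz.size_eq
    refine ⟨fun n => if n ≤ y.size then f n else z, by simp [h1, h3], by simp [hs], by omega, ?_⟩
    intro n hn hn'
    rcases lt_or_eq_of_le (show n ≤ y.size by omega) with h | h
    · have : n + 1 ≤ y.size := h
      simpa [h.le, this] using h4 n hn h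
    · subst h
      simpa [h2] using hyz

theorem Template.exists_path (t : Template) : ∃ τ, IsPath τ ∧ t.FilledBy τ := by
  let g : ℕ → Zigzag := fun N => match N with
    | 0 => .empty
    | N + 1 => .ofWord (t.word N)
  have hg : ∀ N, (g N).Below (g (N + 1)) := by
    intro N
    cases N with
    | zero => exact Zigzag.empty_below _
    | succ N => exact Zigzag.below_of_sublist (t.word_sublist (Nat.le_succ N))
  choose f hf1 hf2 hf3 hf4 using fun N => Zigzag.exists_saturated (hg N)
  have hmono : Monotone fun N => (g N).size := monotone_nat_of_le_succ hf3
  have hlarge : ∀ n, ∃ N, n < (g (N + 1)).size := fun n =>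
    ⟨n, Nat.lt_succ_of_le (t.le_length_word n)⟩
  classical
  let K : ℕ → ℕ := fun n => Nat.find (hlarge n)
  have hK : ∀ n, n < (g (K n + 1)).size := fun n => Nat.find_spec (hlarge n)
  have hK' : ∀ n, (g (K n)).size ≤ n := by
    intro n
    rcases h : K n with _ | k
    · exact Nat.zero_le _
    · by_contra hc
      exact Nat.find_min (hlarge n) (show k < K n by omega) (by omega)
  have hval : ∀ N, f (K (g N).size) (g N).size = g N := by
    intro N
    have h1 := hK (g N).size
    have h2 := hK' (g N).size
    have hle : N ≤ K (g N).size := by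
      by_contra hc
      exact absurd (hmono (show K (g N).size + 1 ≤ N by omega)) (by simpa using h1)
    have heq : ∀ M, N ≤ M → (g M).size ≤ (g N).size → g M = g N := by
      intro M hM
      induction M, hM using Nat.le_induction with
      | base => intro _; rfl
      | succ M hM ih =>
        intro hs
        have a1 := hf3 M
        have a2 : (g N).size ≤ (g M).size := hmono hM
        rw [← ih (by omega), ← hf2 M, ← hf1 M]
        congr 1
        omega
    have e := heq _ hle h2
    have := hf1 (K (g N).size)
    rwa [e] at this
  have hstep : ∀ n, (f (K n) n).Edge (f (K (n + 1)) (n + 1)) := by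
    intro n
    have h := hf4 (K n) n (hK' n) (hK n)
    rcases lt_or_eq_of_le (Nat.succ_le_of_lt (hK n)) with h1 | h1
    · have : K (n + 1) = K n := by
        have b1 : K (n + 1) ≤ K n := Nat.find_min' (hlarge (n + 1)) h1
        have b2 : K n ≤ K (n + 1) :=
          Nat.find_min' (hlarge n) (lt_trans (Nat.lt_succ_self n) (hK (n + 1)))
        exact le_antisymm b1 b2
      rwa [this]
    · have h2 := hval (K n + 1)
      rw [← h1] at h2
      have h3 := hf2 (K n)
      rw [← h1] at h3
      change (f (K n) n).Edge (f (K n.succ) n.succ)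
      rw [h2, ← h3]
      exact h
  refine ⟨fun n => f (K n) n, ⟨?_, hstep⟩, 0, fun N _ => ⟨(g (N + 1)).size, hval (N + 1)⟩⟩
  exact hval 0

/-! ### Oriented paintboxes -/

/-- A pair of disjoint open subsets of `(0,1)`. -/
structure OrientedPaintbox where
  pos : Set ℝ
  neg : Set ℝ
  isOpen_pos : IsOpen pos
  isOpen_neg : IsOpen neg
  pos_subset : pos ⊆ Set.Ioo 0 1
  neg_subset : neg ⊆ Set.Ioo 0 1
  disjoint : Disjoint pos neg

/-- The endpoints `(a, b)` of the interval components of an open set of reals. -/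
def components (U : Set ℝ) : Set (ℝ × ℝ) :=
  {p | p.1 < p.2 ∧ Set.Ioo p.1 p.2 ⊆ U ∧ p.1 ∉ U ∧ p.2 ∉ U}

/-- The points `x` and `y` lie in the same interval component of `U`. -/
def SameInterval (U : Set ℝ) (x y : ℝ) : Prop :=
  ∃ p ∈ components U, x ∈ Set.Ioo p.1 p.2 ∧ y ∈ Set.Ioo p.1 p.2

theorem exists_component {U : Set ℝ} (hU : IsOpen U) (h01 : U ⊆ Set.Ioo 0 1) {x : ℝ} (hx : x ∈ U) :
    ∃ p ∈ components U, x ∈ Set.Ioo p.1 p.2 := by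
  have hx01 := h01 hx
  have h0 : (0 : ℝ) ∉ U := fun h => lt_irrefl _ (h01 h).1
  have h1 : (1 : ℝ) ∉ U := fun h => lt_irrefl _ (h01 h).2
  let A := Set.Iic x ∩ Uᶜ
  let B := Set.Ici x ∩ Uᶜ
  have hA : BddAbove A := ⟨x, fun y hy => hy.1⟩
  have hB : BddBelow B := ⟨x, fun y hy => hy.1⟩
  have ha := (isClosed_Iic.inter hU.isClosed_compl).csSup_mem (s := A) ⟨0, hx01.1.le, h0⟩ hA
  have hb := (isClosed_Ici.inter hU.isClosed_compl).csInf_mem (s := B) ⟨1, hx01.2.le, h1⟩ hB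
  have hax : sSup A < x := lt_of_le_of_ne ha.1 fun h => ha.2 (h ▸ hx)
  have hxb : x < sInf B := lt_of_le_of_ne hb.1 fun h => hb.2 (h ▸ hx)
  refine ⟨(sSup A, sInf B), ⟨hax.trans hxb, ?_, ha.2, hb.2⟩, hax, hxb⟩
  intro y hy
  by_contra hyU
  rcases le_total y x with h | h
  · exact absurd (le_csSup hA ⟨h, hyU⟩) (not_le.2 hy.1)
  · exact absurd (csInf_le hB ⟨h, hyU⟩) (not_le.2 hy.2)

theorem components_unique {U : Set ℝ} {p q : ℝ × ℝ} (hp : p ∈ components U)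
    (hq : q ∈ components U) {x : ℝ} (hxp : x ∈ Set.Ioo p.1 p.2) (hxq : x ∈ Set.Ioo q.1 q.2) :
    p = q := by
  obtain ⟨_, hp2, hp3, hp4⟩ := hp
  obtain ⟨_, hq2, hq3, hq4⟩ := hq
  have h1 : ¬ p.1 < q.1 := fun h => hq3 (hp2 ⟨h, hxq.1.trans hxp.2⟩)
  have h2 : ¬ q.1 < p.1 := fun h => hp3 (hq2 ⟨h, hxp.1.trans hxq.2⟩)
  have h3 : ¬ p.2 < q.2 := fun h => hp4 (hq2 ⟨hxq.1.trans hxp.2, h⟩)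
  have h4 : ¬ q.2 < p.2 := fun h => hq4 (hp2 ⟨hxp.1.trans hxq.2, h⟩)
  exact Prod.ext (le_antisymm (not_lt.1 h2) (not_lt.1 h1)) (le_antisymm (not_lt.1 h4) (not_lt.1 h3))

namespace OrientedPaintbox

variable (w : OrientedPaintbox)

/-- A finitary oriented paintbox: both open sets have finitely many interval components, and their
total length is one. -/
def IsFinitary : Prop :=
  (components w.pos).Finite ∧ (components w.neg).Finite ∧ volume w.pos + volume w.neg = 1

/-! #### The function attached to an oriented paintbox

Throw independent uniform random points `x 0, …, x (n - 1)` on `(0,1)` and order the labels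
`0, …, n - 1` as their points are ordered from left to right, except that labels in one component of
`w.pos` are put in increasing order and labels in one component of `w.neg` in decreasing order. The
list of the labels in this order is the one-line notation of a random permutation. -/

/-- The label `i` precedes the label `j` in the order determined by the points `x`. -/
def Precedes {n : ℕ} (x : Fin n → ℝ) (i j : Fin n) : Prop :=
  (SameInterval w.pos (x i) (x j) ∧ i < j) ∨ (SameInterval w.neg (x i) (x j) ∧ j < i) ∨
    (¬ SameInterval w.pos (x i) (x j) ∧ ¬ SameInterval w.neg (x i) (x j) ∧ x i < x j)

/-- The law of `n` independent uniform points of `(0,1)`. -/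
def uniformPoints (n : ℕ) : Measure (Fin n → ℝ) :=
  Measure.pi fun _ => volume.restrict (Set.Ioo (0 : ℝ) 1)

/-- The probability that the random permutation has the one-line notation
`σ 0, σ 1, …, σ (n - 1)`. -/
def permProb {n : ℕ} (σ : Equiv.Perm (Fin n)) : ℝ≥0∞ :=
  uniformPoints n {x | ∀ i j, i < j → w.Precedes x (σ i) (σ j)}

end OrientedPaintbox

/-- The sequence of ascents (`+`) and descents (`-`) of the one-line notation of `σ`. -/
def ascents {n : ℕ} (σ : Equiv.Perm (Fin (n + 1))) : Fin n → Bool :=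
  fun i => decide (σ i.castSucc < σ i.succ)

theorem exists_perm {n : ℕ} (s : Fin n → Bool) :
    ∃ σ : Equiv.Perm (Fin (n + 1)), ascents σ = s := by
  let v : Fin (n + 1) → ℤ := Fin.cons 0 fun i => if s i then (i : ℤ) + 1 else -((i : ℤ) + 1)
  have habs : ∀ i, |v i| = i := by
    intro i
    refine Fin.cases ?_ (fun i => ?_) i
    · simp [v]
    · simp only [v, Fin.cons_succ, Fin.val_succ]
      split_ifs
      · rw [abs_of_nonneg (by positivity)]; push_cast; ring
      · rw [abs_neg, abs_of_nonneg (by positivity)]; push_cast; ring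
  have hinj : Function.Injective v := by
    intro i j h
    have := habs i
    rw [h, habs j] at this
    exact Fin.ext (by exact_mod_cast this.symm)
  have hmono : StrictMono (v ∘ Tuple.sort v) :=
    (Tuple.monotone_sort v).strictMono_of_injective (hinj.comp (Tuple.sort v).injective)
  refine ⟨(Tuple.sort v)⁻¹, ?_⟩
  funext i
  have h1 : (Tuple.sort v)⁻¹ i.castSucc < (Tuple.sort v)⁻¹ i.succ ↔ v i.castSucc < v i.succ := by
    rw [← hmono.lt_iff_lt]
    simp [Equiv.Perm.inv_def]
  have h2 := habs i.castSucc
  rw [Fin.val_castSucc] at h2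
  have h3 := le_abs_self (v i.castSucc)
  have h4 := neg_abs_le (v i.castSucc)
  have h5 : v i.succ = if s i then (i : ℤ) + 1 else -((i : ℤ) + 1) := by simp [v]
  simp only [ascents, h1]
  cases hs : s i
  · simp only [hs] at h5
    simp at h5
    exact decide_eq_false (by omega)
  · simp only [hs, if_true] at h5
    exact decide_eq_true (by omega)

/-- The function of `w` on the zigzag graph: its value at a nonempty zigzag is the probability that
the random permutation is equal to a given permutation with that sequence of ascents and descents.
By `OrientedPaintbox.phi_ascents` the choice of the permutation does not matter, and by
`OrientedPaintbox.phi_eq_kerov` the function is the one of Kerov's construction if `w` is finitary. -/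
def OrientedPaintbox.phi (w : OrientedPaintbox) : Zigzag → ℝ≥0∞
  | .empty => 1
  | .ofWord a => w.permProb (Classical.choose (exists_perm a.get))

namespace OrientedPaintbox

variable (w : OrientedPaintbox)

/-- The relation between consecutive points that corresponds to a symbol. -/
def Link (s : Bool) (u v : ℝ) : Prop :=
  (SameInterval w.pos u v ∧ s = true) ∨ (SameInterval w.neg u v ∧ s = false) ∨
    (¬ SameInterval w.pos u v ∧ ¬ SameInterval w.neg u v ∧ u < v)

theorem sameInterval_trans {U : Set ℝ} {x y z : ℝ} (h1 : SameInterval U x y)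
    (h2 : SameInterval U y z) : SameInterval U x z := by
  obtain ⟨p, hp, hx, hy⟩ := h1
  obtain ⟨q, hq, hy', hz⟩ := h2
  obtain rfl := components_unique hp hq hy hy'
  exact ⟨p, hp, hx, hz⟩

theorem sameInterval_symm {U : Set ℝ} {x y : ℝ} (h1 : SameInterval U x y) : SameInterval U y x := by
  obtain ⟨p, hp, hx, hy⟩ := h1
  exact ⟨p, hp, hy, hx⟩

theorem sameInterval_ordConnected {U : Set ℝ} {x y z : ℝ} (h : SameInterval U x z) (h1 : x ≤ y)
    (h2 : y ≤ z) : SameInterval U x y := by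
  obtain ⟨p, hp, hx, hz⟩ := h
  exact ⟨p, hp, hx, hx.1.trans_le h1, h2.trans_lt hz.2⟩

theorem not_sameInterval_both {x y z : ℝ} (h1 : SameInterval w.pos x y)
    (h2 : SameInterval w.neg y z) : False := by
  obtain ⟨p, hp, _, hy⟩ := h1
  obtain ⟨q, hq, hy', _⟩ := h2
  exact Set.disjoint_left.1 w.disjoint (hp.2.1 hy) (hq.2.1 hy')

/-- Points of different intervals are ordered as the intervals are. -/
theorem sameInterval_lt {U : Set ℝ} {x y z : ℝ} (h1 : SameInterval U x y)
    (h2 : ¬ SameInterval U y z) (h : y < z) : x < z := by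
  by_contra hc
  exact h2 (sameInterval_ordConnected (sameInterval_symm h1) h.le (not_lt.1 hc))

theorem sameInterval_lt' {U : Set ℝ} {x y z : ℝ} (h1 : SameInterval U y z)
    (h2 : ¬ SameInterval U x y) (h : x < y) : x < z := by
  by_contra hc
  apply h2
  exact sameInterval_trans (sameInterval_symm (sameInterval_ordConnected
    (sameInterval_symm h1) (not_lt.1 hc) h.le)) (sameInterval_symm h1)

/-- `Precedes` for abstract labels. -/
def Prec {ι : Type} [LT ι] (i j : ι) (u v : ℝ) : Prop :=
  (SameInterval w.pos u v ∧ i < j) ∨ (SameInterval w.neg u v ∧ j < i) ∨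
    (¬ SameInterval w.pos u v ∧ ¬ SameInterval w.neg u v ∧ u < v)

theorem Prec.trans {ι : Type} [LinearOrder ι] {i j k : ι} {x y z : ℝ} (h1 : w.Prec i j x y)
    (h2 : w.Prec j k y z) : w.Prec i k x z := by
  rcases h1 with ⟨a, b⟩ | ⟨a, b⟩ | ⟨a, b, c⟩
  · rcases h2 with ⟨a', b'⟩ | ⟨a', b'⟩ | ⟨a', b', c'⟩
    · exact .inl ⟨sameInterval_trans a a', b.trans b'⟩
    · exact (w.not_sameInterval_both a a').elim
    · refine .inr (.inr ⟨fun h => a' (sameInterval_trans (sameInterval_symm a) h), fun h => ?_,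
        sameInterval_lt a a' c'⟩)
      exact w.not_sameInterval_both (sameInterval_symm a) h
  · rcases h2 with ⟨a', b'⟩ | ⟨a', b'⟩ | ⟨a', b', c'⟩
    · exact (w.not_sameInterval_both (sameInterval_symm a') (sameInterval_symm a)).elim
    · exact .inr (.inl ⟨sameInterval_trans a a', b'.trans b⟩)
    · refine .inr (.inr ⟨fun h => ?_, fun h => b' (sameInterval_trans (sameInterval_symm a) h),
        sameInterval_lt a b' c'⟩)
      exact w.not_sameInterval_both (sameInterval_symm h) a
  · rcases h2 with ⟨a', b'⟩ | ⟨a', b'⟩ | ⟨a', b', c'⟩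
    · refine .inr (.inr ⟨fun h => a (sameInterval_trans h (sameInterval_symm a')), fun h => ?_,
        sameInterval_lt' a' a c⟩)
      exact w.not_sameInterval_both a' (sameInterval_symm h)
    · refine .inr (.inr ⟨fun h => ?_, fun h => b (sameInterval_trans h (sameInterval_symm a')),
        sameInterval_lt' a' b c⟩)
      exact w.not_sameInterval_both h (sameInterval_symm a')
    · exact .inr (.inr ⟨fun h => a (sameInterval_ordConnected h c.le c'.le),
        fun h => b (sameInterval_ordConnected h c.le c'.le), c.trans c'⟩)

theorem permProb_eq {n : ℕ} (σ : Equiv.Perm (Fin (n + 1))) :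
    w.permProb σ = uniformPoints (n + 1)
      {y | ∀ i : Fin n, w.Link (ascents σ i) (y i.castSucc) (y i.succ)} := by
  have hequiv : (fun x : Fin (n + 1) → ℝ => x ∘ σ) =
      (MeasurableEquiv.piCongrLeft (fun _ : Fin (n + 1) => ℝ) σ.symm) := by
    funext x i
    obtain ⟨j, rfl⟩ := σ.symm.surjective i
    simp [MeasurableEquiv.piCongrLeft]
  have hmp : MeasurePreserving
      (MeasurableEquiv.piCongrLeft (fun _ : Fin (n + 1) => ℝ) σ.symm) (uniformPoints (n + 1))
      (uniformPoints (n + 1)) :=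
    measurePreserving_piCongrLeft
      (fun _ : Fin (n + 1) => (volume.restrict (Set.Ioo (0 : ℝ) 1))) σ.symm
  rw [permProb]
  conv_rhs => rw [← hmp.measure_preimage_equiv, ← hequiv]
  congr 1
  ext x
  have hlink : ∀ i : Fin n, w.Link (ascents σ i) (x (σ i.castSucc)) (x (σ i.succ)) ↔
      w.Prec (σ i.castSucc) (σ i.succ) (x (σ i.castSucc)) (x (σ i.succ)) := by
    intro i
    have hne : σ i.castSucc ≠ σ i.succ := fun h =>
      (Fin.castSucc_lt_succ (i := i)).ne (σ.injective h)
    have : ¬ σ i.castSucc < σ i.succ ↔ σ i.succ < σ i.castSucc := by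
      rw [not_lt]; exact ⟨fun h => lt_of_le_of_ne h hne.symm, le_of_lt⟩
    simp only [Link, Prec, ascents, decide_eq_true_eq, decide_eq_false_iff_not, this]
  constructor
  · intro h i
    exact (hlink i).2 (h _ _ Fin.castSucc_lt_succ)
  · intro h i j hij
    change w.Prec (σ i) (σ j) (x (σ i)) (x (σ j))
    revert hij
    refine Fin.induction (motive := fun j => i < j →
      w.Prec (σ i) (σ j) (x (σ i)) (x (σ j))) (fun h => absurd h (Fin.not_lt_zero _)) ?_ j
    intro k ih hk
    have hstep := (hlink k).1 (h k)
    rcases lt_or_eq_of_le (Fin.le_castSucc_iff.2 hk) with h1 | h1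
    · exact (ih h1).trans w hstep
    · rw [h1]; exact hstep

/-- The value at a zigzag in terms of the points listed in the order of the labels. -/
theorem phi_ofWord (a : List Bool) :
    w.phi (.ofWord a) = uniformPoints (a.length + 1)
      {y | ∀ i : Fin a.length, w.Link (a.get i) (y i.castSucc) (y i.succ)} := by
  rw [phi, permProb_eq, Classical.choose_spec (exists_perm a.get)]

/-- The value at a zigzag is the probability of any permutation with these ascents and descents. -/
theorem phi_ascents {n : ℕ} (σ : Equiv.Perm (Fin (n + 1))) :
    w.phi (.ofWord (List.ofFn (ascents σ))) = w.permProb σ := by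
  rw [phi_ofWord, permProb_eq]
  generalize ascents σ = s
  have key : ∀ (a : List Bool) (h : a.length = n), (∀ i, a.get i = s (i.cast h)) →
      uniformPoints (a.length + 1)
        {y | ∀ i : Fin a.length, w.Link (a.get i) (y i.castSucc) (y i.succ)} =
      uniformPoints (n + 1) {y | ∀ i : Fin n, w.Link (s i) (y i.castSucc) (y i.succ)} := by
    rintro a rfl h
    simp only [h]
    rfl
  exact key _ (by simp) (by intro i; simp; rfl)

/-! #### The ordered intervals of a finitary oriented paintbox -/

variable {w}

/-- The left endpoints of the intervals. -/
def leftEnds (h : w.IsFinitary) : Finset ℝ :=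
  (h.1.toFinset ∪ h.2.1.toFinset).image Prod.fst

/-- The number of intervals. -/
def numIntervals (h : w.IsFinitary) : ℕ := (leftEnds h).card

/-- The left endpoint of the `i`-th interval, counted from left to right. -/
def leftEnd (h : w.IsFinitary) (i : Fin (numIntervals h)) : ℝ := (leftEnds h).orderEmbOfFin rfl i

theorem exists_rightEnd (h : w.IsFinitary) (i : Fin (numIntervals h)) :
    ∃ b, (leftEnd h i, b) ∈ components w.pos ∪ components w.neg := by
  have := (leftEnds h).orderEmbOfFin_mem rfl i
  simp only [leftEnds, Finset.mem_image, Finset.mem_union, Set.Finite.mem_toFinset] at this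
  obtain ⟨p, hp, hpi⟩ := this
  refine ⟨p.2, ?_⟩
  have : (leftEnd h i, p.2) = p := Prod.ext hpi.symm rfl
  rw [this]
  exact hp

/-- The right endpoint of the `i`-th interval. -/
def rightEnd (h : w.IsFinitary) (i : Fin (numIntervals h)) : ℝ :=
  Classical.choose (exists_rightEnd h i)

open Classical in
/-- The orientation of the `i`-th interval: `+` if it is an interval of `w.pos`, and `-` if it is an
interval of `w.neg`. -/
def orientation (h : w.IsFinitary) (i : Fin (numIntervals h)) : Bool :=
  decide ((leftEnd h i, rightEnd h i) ∈ components w.pos)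

theorem mem_components (h : w.IsFinitary) (i : Fin (numIntervals h)) :
    (leftEnd h i, rightEnd h i) ∈ components w.pos ∪ components w.neg :=
  Classical.choose_spec (exists_rightEnd h i)

theorem leftEnd_lt_rightEnd (h : w.IsFinitary) (i : Fin (numIntervals h)) :
    leftEnd h i < rightEnd h i := by
  rcases mem_components h i with h | h <;> exact h.1

theorem eq_of_mem_components (w : OrientedPaintbox) {p q : ℝ × ℝ}
    (hp : p ∈ components w.pos ∪ components w.neg) (hq : q ∈ components w.pos ∪ components w.neg)
    {x : ℝ} (hxp : x ∈ Set.Ioo p.1 p.2) (hxq : x ∈ Set.Ioo q.1 q.2) : p = q := by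
  rcases hp with hp | hp <;> rcases hq with hq | hq
  · exact components_unique hp hq hxp hxq
  · exact (Set.disjoint_left.1 w.disjoint (hp.2.1 hxp) (hq.2.1 hxq)).elim
  · exact (Set.disjoint_left.1 w.disjoint (hq.2.1 hxq) (hp.2.1 hxp)).elim
  · exact components_unique hp hq hxp hxq

theorem leftEnd_strictMono (h : w.IsFinitary) : StrictMono (leftEnd h) :=
  ((leftEnds h).orderEmbOfFin rfl).strictMono

theorem exists_index (h : w.IsFinitary) {p : ℝ × ℝ}
    (hp : p ∈ components w.pos ∪ components w.neg) :
    ∃ i, (leftEnd h i, rightEnd h i) = p := by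
  have hmem : p.1 ∈ leftEnds h := by
    simp only [leftEnds, Finset.mem_image, Finset.mem_union, Set.Finite.mem_toFinset]
    exact ⟨p, hp, rfl⟩
  have hr := Finset.range_orderEmbOfFin (leftEnds h) rfl
  obtain ⟨i, hi⟩ : p.1 ∈ Set.range ((leftEnds h).orderEmbOfFin rfl) := by rw [hr]; exact hmem
  have hi' : leftEnd h i = p.1 := hi
  have hlt : p.1 < p.2 := by rcases hp with hp | hp <;> exact hp.1
  have hlt' := leftEnd_lt_rightEnd h i
  refine ⟨i, ?_⟩
  obtain ⟨x, hx1, hx2⟩ := exists_between (lt_min hlt (hi' ▸ hlt'))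
  rw [lt_min_iff] at hx2
  exact eq_of_mem_components w (mem_components h i) hp ⟨hi' ▸ hx1, hx2.2⟩ ⟨hx1, hx2.1⟩

theorem exists_mem_interval (h : w.IsFinitary) {x : ℝ} (hx : x ∈ w.pos ∪ w.neg) :
    ∃ i, x ∈ Set.Ioo (leftEnd h i) (rightEnd h i) := by
  obtain ⟨p, hp, hxp⟩ : ∃ p ∈ components w.pos ∪ components w.neg, x ∈ Set.Ioo p.1 p.2 := by
    rcases hx with hx | hx
    · obtain ⟨p, hp, h⟩ := exists_component w.isOpen_pos w.pos_subset hx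
      exact ⟨p, .inl hp, h⟩
    · obtain ⟨p, hp, h⟩ := exists_component w.isOpen_neg w.neg_subset hx
      exact ⟨p, .inr hp, h⟩
  obtain ⟨i, rfl⟩ := exists_index h hp
  exact ⟨i, hxp⟩

theorem numIntervals_pos (h : w.IsFinitary) : 0 < numIntervals h := by
  have : (w.pos ∪ w.neg).Nonempty := by
    rw [Set.nonempty_iff_ne_empty]
    intro he
    rw [Set.union_empty_iff] at he
    have := h.2.2
    simp [he.1, he.2] at this
  obtain ⟨x, hx⟩ := this
  obtain ⟨i, _⟩ := exists_mem_interval h hx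
  exact i.pos

/-! #### Kerov's formula -/

theorem eq_of_mem_intervals (h : w.IsFinitary) {i j : Fin (numIntervals h)} {x : ℝ}
    (hi : x ∈ Set.Ioo (leftEnd h i) (rightEnd h i))
    (hj : x ∈ Set.Ioo (leftEnd h j) (rightEnd h j)) : i = j := by
  have := eq_of_mem_components w (mem_components h i) (mem_components h j) hi hj
  exact (leftEnd_strictMono h).injective (congrArg Prod.fst this)

theorem lt_of_mem_intervals (h : w.IsFinitary) {i j : Fin (numIntervals h)} {x y : ℝ}
    (hi : x ∈ Set.Ioo (leftEnd h i) (rightEnd h i))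
    (hj : y ∈ Set.Ioo (leftEnd h j) (rightEnd h j)) (hij : i < j) : x < y := by
  by_contra hc
  refine hij.ne (eq_of_mem_intervals h ⟨?_, ?_⟩ hj)
  · exact (leftEnd_strictMono h hij).trans hj.1
  · exact (not_lt.1 hc).trans_lt hi.2

open Classical in
theorem sameInterval_pos_iff (h : w.IsFinitary) {i j : Fin (numIntervals h)} {x y : ℝ}
    (hi : x ∈ Set.Ioo (leftEnd h i) (rightEnd h i))
    (hj : y ∈ Set.Ioo (leftEnd h j) (rightEnd h j)) :
    SameInterval w.pos x y ↔ i = j ∧ orientation h i = true := by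
  constructor
  · rintro ⟨p, hp, hx, hy⟩
    have h1 := eq_of_mem_components w (mem_components h i) (.inl hp) hi hx
    have h2 := eq_of_mem_components w (mem_components h j) (.inl hp) hj hy
    refine ⟨(leftEnd_strictMono h).injective (congrArg Prod.fst (h1.trans h2.symm)), ?_⟩
    rw [orientation, h1]
    exact decide_eq_true_iff.2 hp
  · rintro ⟨rfl, ho⟩
    exact ⟨_, of_decide_eq_true ho, hi, hj⟩

open Classical in
theorem sameInterval_neg_iff (h : w.IsFinitary) {i j : Fin (numIntervals h)} {x y : ℝ}
    (hi : x ∈ Set.Ioo (leftEnd h i) (rightEnd h i))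
    (hj : y ∈ Set.Ioo (leftEnd h j) (rightEnd h j)) :
    SameInterval w.neg x y ↔ i = j ∧ orientation h i = false := by
  constructor
  · rintro ⟨p, hp, hx, hy⟩
    have h1 := eq_of_mem_components w (mem_components h i) (.inr hp) hi hx
    have h2 := eq_of_mem_components w (mem_components h j) (.inr hp) hj hy
    refine ⟨(leftEnd_strictMono h).injective (congrArg Prod.fst (h1.trans h2.symm)), ?_⟩
    rw [orientation, h1]
    exact decide_eq_false fun hp' => Set.disjoint_left.1 w.disjoint (hp'.2.1 hx) (hp.2.1 hx)
  · rintro ⟨rfl, ho⟩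
    exact ⟨_, (mem_components h i).resolve_left (of_decide_eq_false ho), hi, hj⟩

theorem link_iff (h : w.IsFinitary) {i j : Fin (numIntervals h)} {x y : ℝ} {s : Bool}
    (hi : x ∈ Set.Ioo (leftEnd h i) (rightEnd h i))
    (hj : y ∈ Set.Ioo (leftEnd h j) (rightEnd h j)) :
    w.Link s x y ↔ i ≤ j ∧ (i = j → s = orientation h i) := by
  rw [Link, sameInterval_pos_iff h hi hj, sameInterval_neg_iff h hi hj]
  rcases lt_trichotomy i j with hij | rfl | hij
  · simp [hij.ne, hij.le, lt_of_mem_intervals h hi hj hij]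
  · cases s <;> cases orientation h i <;> simp
  · simp [hij.ne', not_le.2 hij, (lt_of_mem_intervals h hj hi hij).le]

open Classical in
/-- Kerov's formula: the sum, over all splittings of a zigzag into consecutive, possibly empty
pieces, one for each interval, which are rows for the positively oriented intervals and columns for
the negatively oriented ones, of the product of the powers of the lengths of the intervals with
exponents the numbers of boxes of the pieces. A splitting is given by the monotone map `f` that
sends the `i`-th box to the number of its piece. -/
theorem phi_eq_kerov (h : w.IsFinitary) (a : List Bool) :
    w.phi (.ofWord a) =
      ∑ f : Fin (a.length + 1) → Fin (numIntervals h) with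
          Monotone f ∧
            ∀ i : Fin a.length, f i.castSucc = f i.succ → a.get i = orientation h (f i.castSucc),
        ∏ i, ENNReal.ofReal (rightEnd h (f i) - leftEnd h (f i)) := by
  let I : Fin (numIntervals h) → Set ℝ := fun k => Set.Ioo (leftEnd h k) (rightEnd h k)
  have hI : ∀ k, I k ⊆ Set.Ioo (0 : ℝ) 1 := by
    intro k
    rcases mem_components h k with hk | hk
    · exact hk.2.1.trans w.pos_subset
    · exact hk.2.1.trans w.neg_subset
  have hae1 : ∀ᵐ x ∂(volume.restrict (Set.Ioo (0 : ℝ) 1)), ∃ k, x ∈ I k := by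
    have hm : MeasurableSet (w.pos ∪ w.neg) := (w.isOpen_pos.union w.isOpen_neg).measurableSet
    have hv : volume (w.pos ∪ w.neg) = 1 := by
      rw [measure_union w.disjoint w.isOpen_neg.measurableSet, h.2.2]
    have hz : volume (Set.Ioo (0 : ℝ) 1 \ (w.pos ∪ w.neg)) = 0 := by
      rw [measure_sdiff (Set.union_subset w.pos_subset w.neg_subset) hm.nullMeasurableSet
        (by simp [hv]), hv]
      simp
    rw [ae_restrict_iff' measurableSet_Ioo]
    refine measure_mono_null ?_ hz
    intro x hx
    simp only [Set.mem_compl_iff, Set.mem_ofPred_eq, Classical.not_imp] at hx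
    exact ⟨hx.1, fun hx' => hx.2 (exists_mem_interval h hx')⟩
  have hae : ∀ᵐ y ∂(uniformPoints (a.length + 1)), ∀ i, ∃ k, y i ∈ I k := by
    rw [ae_all_iff]
    intro i
    exact (Measure.quasiMeasurePreserving_eval
      (fun _ : Fin (a.length + 1) => volume.restrict (Set.Ioo (0 : ℝ) 1)) i).ae hae1
  set G := Finset.univ.filter fun f : Fin (a.length + 1) → Fin (numIntervals h) =>
    Monotone f ∧
      ∀ i : Fin a.length, f i.castSucc = f i.succ → a.get i = orientation h (f i.castSucc) with hG
  have hset : {y | ∀ i : Fin a.length, w.Link (a.get i) (y i.castSucc) (y i.succ)}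
      =ᵐ[uniformPoints (a.length + 1)] ⋃ f ∈ G, Set.univ.pi fun i => I (f i) := by
    have hkey : ∀ (y : Fin (a.length + 1) → ℝ) (f : Fin (a.length + 1) → Fin (numIntervals h)),
        (∀ i, y i ∈ I (f i)) →
        ((∀ i : Fin a.length, w.Link (a.get i) (y i.castSucc) (y i.succ)) ↔ f ∈ G) := by
      intro y f hf
      rw [hG, Finset.mem_filter, Fin.monotone_iff_le_succ, ← forall_and]
      simp only [Finset.mem_univ, true_and]
      exact forall_congr' fun i => link_iff h (hf _) (hf _)
    filter_upwards [hae] with y hy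
    choose f hf using hy
    apply propext
    change (∀ i : Fin a.length, w.Link (a.get i) (y i.castSucc) (y i.succ)) ↔
      y ∈ ⋃ f ∈ G, Set.univ.pi fun i => I (f i)
    simp only [Set.mem_iUnion, Set.mem_univ_pi, exists_prop]
    constructor
    · intro hl
      exact ⟨f, (hkey y f hf).1 hl, hf⟩
    · rintro ⟨g, hg, hyg⟩
      exact (hkey y g hyg).2 hg
  rw [phi_ofWord, measure_congr hset, measure_biUnion_finset]
  · refine Finset.sum_congr rfl fun f _ => ?_
    rw [uniformPoints, Measure.pi_pi]
    refine Finset.prod_congr rfl fun i _ => ?_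
    rw [Measure.restrict_apply measurableSet_Ioo, Set.inter_eq_left.2 (hI _), Real.volume_Ioo]
  · intro f _ g _ hfg
    rw [Function.onFun, Set.disjoint_left]
    intro y hyf hyg
    exact hfg (funext fun i => eq_of_mem_intervals h (hyf i trivial) (hyg i trivial))
  · intro f _
    exact MeasurableSet.univ_pi fun i => measurableSet_Ioo

end OrientedPaintbox

/-- The clusters obtained from a list of signs by making every sign infinite and inserting between
any two neighbors of the same sign a single symbol of the opposite sign. -/
def signClusters : List Bool → List (Bool × ℕ∞)
  | [] => []
  | [s] => [(s, ⊤)]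
  | s :: s' :: l =>
    if s = s' then (s, ⊤) :: (!s, 1) :: signClusters (s' :: l)
    else (s, ⊤) :: signClusters (s' :: l)

theorem head_signClusters (s : Bool) (l : List Bool) :
    ∃ l', signClusters (s :: l) = (s, ⊤) :: l' := by
  cases l with
  | nil => exact ⟨_, rfl⟩
  | cons s' l =>
    rw [signClusters]
    split_ifs <;> exact ⟨_, rfl⟩

theorem signClusters_ne_zero (l : List Bool) : ∀ c ∈ signClusters l, c.2 ≠ 0 := by
  fun_induction signClusters l <;> simp_all

theorem signClusters_alternating (l : List Bool) :
    (signClusters l).IsChain fun c d => c.1 ≠ d.1 := by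
  fun_induction signClusters l with
  | case1 => exact List.IsChain.nil
  | case2 s => exact List.IsChain.singleton _
  | case3 s l ih =>
    obtain ⟨l', hl⟩ := head_signClusters s l
    rw [hl] at ih ⊢
    refine .cons_cons ?_ (.cons_cons ?_ ih) <;> simp
  | case4 s s' l hne ih =>
    obtain ⟨l', hl⟩ := head_signClusters s' l
    rw [hl] at ih ⊢
    exact .cons_cons hne ih

/-- The template of a finitary oriented paintbox. -/
def OrientedPaintbox.template {w : OrientedPaintbox} (h : w.IsFinitary) : Template where
  clusters := signClusters (List.ofFn (OrientedPaintbox.orientation h))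
  multiplicity_ne_zero := signClusters_ne_zero _
  alternating := signClusters_alternating _
  exists_infinite := by
    obtain ⟨s, l, hl⟩ : ∃ s l, List.ofFn (OrientedPaintbox.orientation h) = s :: l := by
      apply List.exists_cons_of_ne_nil
      rw [Ne, List.ofFn_eq_nil_iff]
      exact (OrientedPaintbox.numIntervals_pos h).ne'
    obtain ⟨l', hl'⟩ := head_signClusters s l
    exact ⟨(s, ⊤), by rw [hl, hl']; simp, rfl⟩

end ZigzagGraph

end

/-!
Suppose first that `w` is finitary. By Kerov's formula the value at a nonempty zigzag is a sum of
positive products over the splittings of the zigzag into rows and columns prescribed by the signs of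
the intervals, so it is positive exactly if a splitting exists. The symbols of the word inside a
piece are the sign of the piece, and a symbol between boxes of different pieces is arbitrary. Such
an arbitrary symbol can be absorbed by one of the two neighboring infinite clusters, unless both
have the opposite sign, when it is the symbol inserted between them. Hence a splitting exists
exactly if the word is a subword of some word `t_w^(N)` (`splits_iff_exists_sublist`), and subwords
are the elements of the coideal (`Zigzag.below_iff_sublist`).

If `w` is not finitary, then for every `n` there are sets `A 0 < ⋯ < A (n - 1)` of positive measure
in `(0,1)` such that points of different sets never share an interval: components, if there are
infinitely many of them, and otherwise pieces of the complement of `w_+ ∪ w_-`, which has positive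
measure (`exists_ordered_pieces`). With one point in each set, neighboring points are ordered by
their position and put no condition on the word, so that every word has positive probability
(`phi_pos_of_blocks`).
-/

namespace ZigzagGraph

/-! ### The order on the vertices -/

theorem Zigzag.sublist_of_below {x y : Zigzag} (h : x.Below y) :
    ∀ {a b : List Bool}, x = .ofWord a → y = .ofWord b → a.Sublist b := by
  induction h with
  | refl =>
    rintro a b rfl h
    cases h
    exact List.Sublist.refl _
  | tail h1 h2 ih =>
    rintro a b rfl rfl
    cases h2 with
    | box => rcases Relation.ReflTransGen.cases_tail h1 with h | ⟨_, _, h⟩ <;> cases h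
    | delete _ i => exact (ih rfl rfl).trans (List.eraseIdx_sublist b i)

theorem Zigzag.below_iff_sublist {a b : List Bool} :
    (Zigzag.ofWord a).Below (.ofWord b) ↔ a.Sublist b :=
  ⟨fun h => Zigzag.sublist_of_below h rfl rfl, Zigzag.below_of_sublist⟩

/-! ### Splittings of a zigzag into rows and columns -/

/-- `Splits S a`: the nonempty zigzag with word `a` can be cut into consecutive, possibly empty
pieces, one for each sign of `S`, which are rows for the sign `+` and columns for the sign `-`.
The zigzag is read box by box: `nil` puts the last box into the current piece, `stay` puts the
current box and the next one into the current piece, `cross` makes the current box the last one of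
its piece, and `skip` leaves the current piece. -/
inductive Splits : List Bool → List Bool → Prop
  | nil (s : Bool) (S : List Bool) : Splits (s :: S) []
  | stay {s : Bool} {S a : List Bool} : Splits (s :: S) a → Splits (s :: S) (s :: a)
  | cross {S a : List Bool} (s c : Bool) : Splits S a → Splits (s :: S) (c :: a)
  | skip {S a : List Bool} (s : Bool) : Splits S a → Splits (s :: S) a

theorem Splits.replicate_append {s : Bool} {S b : List Bool} (h : Splits (s :: S) b) (k : ℕ) :
    Splits (s :: S) (List.replicate k s ++ b) := by
  induction k with
  | zero => exact h
  | succ k ih => exact ih.stay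

theorem Splits.append_left {S a : List Bool} (h : Splits S a) (T : List Bool) :
    Splits (T ++ S) a := by
  induction T with
  | nil => exact h
  | cons s T ih => exact ih.skip s

theorem Splits.drop_mono {S a : List Bool} {j k : ℕ} (hjk : j ≤ k) (h : Splits (S.drop k) a) :
    Splits (S.drop j) a := by
  obtain ⟨d, rfl⟩ := Nat.exists_eq_add_of_le hjk
  rw [← List.drop_drop] at h
  rw [← List.take_append_drop d (S.drop j)]
  exact h.append_left _

theorem clusterWord_cons (c : Bool × ℕ∞) (l : List (Bool × ℕ∞)) (N : ℕ) :
    clusterWord (c :: l) N =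
      List.replicate (if c.2 = ⊤ then N else c.2.toNat) c.1 ++ clusterWord l N := by
  simp [clusterWord]

theorem clusterWord_signClusters_singleton (s : Bool) (N : ℕ) :
    clusterWord (signClusters [s]) N = List.replicate N s := by
  simp [signClusters, clusterWord]

theorem clusterWord_signClusters_cons_cons (s s' : Bool) (S : List Bool) (N : ℕ) :
    clusterWord (signClusters (s :: s' :: S)) N = List.replicate N s ++
      ((if s = s' then [!s] else []) ++ clusterWord (signClusters (s' :: S)) N) := by
  rw [signClusters]
  split_ifs <;> simp [clusterWord_cons]

theorem clusterWord_sublist (l : List (Bool × ℕ∞)) {M N : ℕ} (h : M ≤ N) :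
    (clusterWord l M).Sublist (clusterWord l N) := by
  induction l with
  | nil => simp [clusterWord]
  | cons c l ih =>
    rw [clusterWord_cons, clusterWord_cons]
    refine List.Sublist.append ?_ ih
    rw [List.replicate_sublist_replicate]
    split_ifs <;> simp [h]

theorem cons_sublist_clusterWord {s : Bool} {S a : List Bool} {N : ℕ}
    (h : a.Sublist (clusterWord (signClusters (s :: S)) N)) :
    (s :: a).Sublist (clusterWord (signClusters (s :: S)) (N + 1)) := by
  obtain ⟨l', hl⟩ := head_signClusters s S
  rw [hl, clusterWord_cons] at h ⊢
  simp only [if_true, List.replicate_succ, List.cons_append] at h ⊢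
  exact (h.trans (List.Sublist.append (List.Sublist.refl _)
    (clusterWord_sublist l' N.le_succ))).cons_cons s

/-- The symbol read at a crossing is free. If it is the sign of the piece that ends, or of the piece
that follows, it is absorbed by an infinite cluster; it can differ from both only if they are equal,
and then it is the inserted symbol. -/
theorem Splits.exists_sublist {S a : List Bool} (h : Splits S a) :
    ∃ N, a.Sublist (clusterWord (signClusters S) N) := by
  induction h with
  | nil s S => exact ⟨0, List.nil_sublist _⟩
  | stay _ ih => exact ih.imp' (· + 1) fun _ => cons_sublist_clusterWord
  | @cross S a s c h ih =>
    obtain ⟨N, hN⟩ := ih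
    refine ⟨N + 1, ?_⟩
    cases S with
    | nil => cases h
    | cons s' S =>
      have hN' := hN.trans (clusterWord_sublist _ N.le_succ)
      rw [clusterWord_signClusters_cons_cons]
      by_cases hc : c = s
      · subst hc
        rw [List.replicate_succ, List.cons_append]
        exact (hN'.trans ((List.sublist_append_right _ _).trans
          (List.sublist_append_right _ _))).cons_cons c
      · refine List.Sublist.trans ?_ (List.sublist_append_right _ _)
        split_ifs with hs
        · obtain rfl : c = !s := by revert hc; cases c <;> cases s <;> simp
          exact hN'.cons_cons _
        · obtain rfl : c = s' := by revert hc hs; cases c <;> cases s <;> cases s' <;> simp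
          exact cons_sublist_clusterWord hN
  | @skip S a s h ih =>
    obtain ⟨N, hN⟩ := ih
    refine ⟨N, ?_⟩
    cases S with
    | nil => cases h
    | cons s' S =>
      rw [clusterWord_signClusters_cons_cons]
      exact hN.trans ((List.sublist_append_right _ _).trans (List.sublist_append_right _ _))

/-- Conversely, a subword of the template word is split greedily. Its part in the first infinite
cluster goes into the first piece. If it uses the symbol inserted between two equal signs, that
symbol is read at a crossing between pieces; otherwise the first piece is left by `skip`. -/
theorem splits_of_sublist {S a : List Bool} (hS : S ≠ []) {N : ℕ}
    (h : a.Sublist (clusterWord (signClusters S) N)) : Splits S a := by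
  induction S generalizing a with
  | nil => exact absurd rfl hS
  | cons s S ih =>
    cases S with
    | nil =>
      rw [clusterWord_signClusters_singleton, List.sublist_replicate_iff] at h
      obtain ⟨k, _, rfl⟩ := h
      simpa using (Splits.nil s []).replicate_append k
    | cons s' S =>
      rw [clusterWord_signClusters_cons_cons, List.sublist_append_iff] at h
      obtain ⟨u, v, rfl, hu, hv⟩ := h
      rw [List.sublist_replicate_iff] at hu
      obtain ⟨k, _, rfl⟩ := hu
      refine Splits.replicate_append ?_ k
      split_ifs at hv
      · rw [List.singleton_append, List.sublist_cons_iff] at hv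
        rcases hv with hv | ⟨r, rfl, hv⟩
        · exact (ih (by simp) hv).skip s
        · exact (ih (by simp) hv).cross s _
      · exact (ih (by simp) hv).skip s

theorem splits_iff_exists_sublist {S a : List Bool} (hS : S ≠ []) :
    Splits S a ↔ ∃ N, a.Sublist (clusterWord (signClusters S) N) :=
  ⟨Splits.exists_sublist, fun ⟨_, h⟩ => splits_of_sublist hS h⟩

/-- The map `f` sends a box to the number of its piece. The pieces before the piece of the first
box are dropped, which makes the statement inductive. -/
theorem splits_drop_of_map {S a : List Bool} (f : ℕ → ℕ) (hlt : ∀ i ≤ a.length, f i < S.length)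
    (hmono : ∀ i < a.length, f i ≤ f (i + 1))
    (heq : ∀ i < a.length, f i = f (i + 1) → a[i]? = S[f i]?) : Splits (S.drop (f 0)) a := by
  induction a generalizing f with
  | nil =>
    rw [List.drop_eq_getElem_cons (hlt 0 le_rfl)]
    exact .nil _ _
  | cons c a ih =>
    have h := ih (fun i => f (i + 1)) (fun i hi => hlt (i + 1) (by simpa using hi))
      (fun i hi => hmono (i + 1) (by simpa using hi))
      (fun i hi h => by simpa using heq (i + 1) (by simpa using hi) h)
    have h0 := hlt 0 (Nat.zero_le _)
    rcases (hmono 0 (by simp)).eq_or_lt with h1 | h1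
    · have hc := heq 0 (by simp) h1
      simp only [zero_add, ← h1] at h
      rw [List.drop_eq_getElem_cons h0] at h ⊢
      rw [List.getElem?_eq_getElem h0] at hc
      simp only [List.getElem?_cons_zero, Option.some.injEq] at hc
      rw [hc]
      exact h.stay
    · rw [List.drop_eq_getElem_cons h0]
      exact (Splits.drop_mono h1 h).cross _ _

theorem Splits.exists_map {S a : List Bool} (h : Splits S a) :
    ∃ f : ℕ → ℕ, (∀ i ≤ a.length, f i < S.length) ∧ (∀ i < a.length, f i ≤ f (i + 1)) ∧
      ∀ i < a.length, f i = f (i + 1) → a[i]? = S[f i]? := by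
  induction h with
  | nil s S => exact ⟨fun _ => 0, by simp, by simp, by simp⟩
  | @stay s S a h ih =>
    obtain ⟨f, h1, h2, h3⟩ := ih
    refine ⟨fun i => Nat.casesOn i 0 f, ?_, ?_, ?_⟩
    · rintro (_ | i) hi
      · simp
      · exact h1 i (by simpa using hi)
    · rintro (_ | i) hi
      · simp
      · exact h2 i (by simpa using hi)
    · rintro (_ | i) hi h
      · simp
      · simpa using h3 i (by simpa using hi) h
  | @cross S a s c h ih =>
    obtain ⟨f, h1, h2, h3⟩ := ih
    refine ⟨fun i => Nat.casesOn i 0 fun i => f i + 1, ?_, ?_, ?_⟩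
    · rintro (_ | i) hi
      · simp
      · simpa using h1 i (by simpa using hi)
    · rintro (_ | i) hi
      · simp
      · simpa using h2 i (by simpa using hi)
    · rintro (_ | i) hi h
      · simp at h
      · simpa using h3 i (by simpa using hi) (by simpa using h)
  | @skip S a s h ih =>
    obtain ⟨f, h1, h2, h3⟩ := ih
    refine ⟨fun i => f i + 1, fun i hi => by simpa using h1 i hi, fun i hi => by simpa using h2 i hi,
      fun i hi h => by simpa using h3 i hi (by simpa using h)⟩

theorem splits_ofFn_iff {m : ℕ} (o : Fin m → Bool) (a : List Bool) :
    Splits (List.ofFn o) a ↔ ∃ f : Fin (a.length + 1) → Fin m, Monotone f ∧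
      ∀ i : Fin a.length, f i.castSucc = f i.succ → a.get i = o (f i.castSucc) := by
  constructor
  · intro h
    obtain ⟨f, h1, h2, h3⟩ := h.exists_map
    refine ⟨fun i => ⟨f i, by simpa using h1 i (by omega)⟩,
      Fin.monotone_iff_le_succ.2 fun i => h2 i i.2, fun i hi => ?_⟩
    have := h3 i i.2 (by simpa using hi)
    have hlt : f i < m := by simpa using h1 i (by omega)
    simpa [hlt] using this
  · rintro ⟨f, hf, h⟩
    let g : ℕ → ℕ := fun i => if hi : i < a.length + 1 then f ⟨i, hi⟩ else 0
    have hg : ∀ i (hi : i < a.length + 1), g i = f ⟨i, hi⟩ := fun i hi => dif_pos hi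
    have key : Splits ((List.ofFn o).drop (g 0)) a := by
      refine splits_drop_of_map g (fun i hi => ?_) (fun i hi => ?_) fun i hi he => ?_
      · rw [hg i (by omega)]
        simp
      · rw [hg i (by omega), hg (i + 1) (by omega)]
        exact hf (by simp [Fin.le_def])
      · rw [hg i (by omega), hg (i + 1) (by omega)] at he
        have := h ⟨i, hi⟩ (Fin.ext he)
        rw [hg i (by omega)]
        simpa [hi] using this
    simpa using Splits.drop_mono (Nat.zero_le _) key

namespace OrientedPaintbox

/-! ### Finitary oriented paintboxes -/

theorem phi_pos_iff_splits {w : OrientedPaintbox} (h : w.IsFinitary) (a : List Bool) :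
    0 < w.phi (.ofWord a) ↔ Splits (List.ofFn (orientation h)) a := by
  classical
  rw [splits_ofFn_iff, phi_eq_kerov, pos_iff_ne_zero, Ne, Finset.sum_eq_zero_iff]
  push Not
  refine exists_congr fun f => ?_
  have hpos : ∏ i, ENNReal.ofReal (rightEnd h (f i) - leftEnd h (f i)) ≠ 0 :=
    Finset.prod_ne_zero_iff.2 fun i _ => by
      simpa using leftEnd_lt_rightEnd h (f i)
  simp only [Finset.mem_filter, Finset.mem_univ, true_and]
  exact and_iff_left hpos

theorem support_phi_of_isFinitary {w : OrientedPaintbox} (h : w.IsFinitary) :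
    support w.phi = (template h).coideal := by
  ext x
  cases x with
  | empty =>
    refine iff_of_true ?_ ⟨0, Zigzag.empty_below _⟩
    simp [support, phi]
  | ofWord a =>
    have hne : List.ofFn (orientation h) ≠ [] := by
      rw [Ne, List.ofFn_eq_nil_iff]
      exact (numIntervals_pos h).ne'
    change 0 < w.phi (.ofWord a) ↔ ∃ N, (Zigzag.ofWord a).Below (.ofWord ((template h).word N))
    simp only [phi_pos_iff_splits h, Zigzag.below_iff_sublist]
    exact splits_iff_exists_sublist hne

/-! ### Other oriented paintboxes -/

variable {w : OrientedPaintbox}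

/-- If there are as many sets of positive measure as boxes, ordered from left to right and such that
no two points of different sets share an interval, then the zigzag has positive probability: when
the `i`-th point lies in the `i`-th set for every `i`, any symbol is allowed between neighbors. -/
theorem phi_pos_of_blocks {a : List Bool} (A : Fin (a.length + 1) → Set ℝ)
    (hA : ∀ i, A i ⊆ Set.Ioo 0 1) (hpos : ∀ i, 0 < volume (A i))
    (hlink : ∀ i j, i < j → ∀ u ∈ A i, ∀ v ∈ A j,
      ¬ SameInterval w.pos u v ∧ ¬ SameInterval w.neg u v ∧ u < v) :
    0 < w.phi (.ofWord a) := by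
  rw [phi_ofWord]
  have hsub : Set.univ.pi A ⊆
      {y | ∀ i : Fin a.length, w.Link (a.get i) (y i.castSucc) (y i.succ)} := fun y hy i =>
    .inr (.inr (hlink _ _ Fin.castSucc_lt_succ _ (hy _ trivial) _ (hy _ trivial)))
  refine lt_of_lt_of_le ?_ (measure_mono hsub)
  rw [uniformPoints, Measure.pi_pi, pos_iff_ne_zero, Finset.prod_ne_zero_iff]
  intro i _
  rw [Measure.restrict_eq_self _ (hA i)]
  exact (hpos i).ne'

theorem phi_pos_of_infinite_components
    (h : (components w.pos ∪ components w.neg).Infinite) (a : List Bool) :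
    0 < w.phi (.ofWord a) := by
  have hinj : Set.InjOn Prod.fst (components w.pos ∪ components w.neg) := by
    intro p hp q hq hpq
    have h1 : p.1 < p.2 := by rcases hp with hp | hp <;> exact hp.1
    have h2 : p.1 < q.2 := by rw [hpq]; rcases hq with hq | hq <;> exact hq.1
    obtain ⟨x, hx1, hx2⟩ := exists_between (lt_min h1 h2)
    rw [lt_min_iff] at hx2
    exact eq_of_mem_components w hp hq ⟨hx1, hx2.1⟩ ⟨hpq ▸ hx1, hx2.2⟩
  obtain ⟨T, hT, hcard⟩ := (h.image hinj).exists_subset_card_eq (a.length + 1)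
  have hmem : ∀ i, ∃ p ∈ components w.pos ∪ components w.neg, p.1 = T.orderEmbOfFin hcard i :=
    fun i => hT (T.orderEmbOfFin_mem hcard i)
  choose p hp hp1 using hmem
  refine phi_pos_of_blocks (fun i => Set.Ioo (p i).1 (p i).2) (fun i => ?_) (fun i => ?_) ?_
  · rcases hp i with hi | hi
    · exact hi.2.1.trans w.pos_subset
    · exact hi.2.1.trans w.neg_subset
  · rw [Real.volume_Ioo, ENNReal.ofReal_pos, sub_pos]
    rcases hp i with hi | hi <;> exact hi.1
  · intro i j hij u hu v hv
    have hlt : (p i).1 < (p j).1 := by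
      rw [hp1, hp1]
      exact (T.orderEmbOfFin hcard).strictMono hij
    have hne : p i ≠ p j := fun h => hlt.ne (congrArg Prod.fst h)
    refine ⟨?_, ?_, ?_⟩
    · rintro ⟨q, hq, hqu, hqv⟩
      exact hne ((eq_of_mem_components w (hp i) (.inl hq) hu hqu).trans
        (eq_of_mem_components w (hp j) (.inl hq) hv hqv).symm)
    · rintro ⟨q, hq, hqu, hqv⟩
      exact hne ((eq_of_mem_components w (hp i) (.inr hq) hu hqu).trans
        (eq_of_mem_components w (hp j) (.inr hq) hv hqv).symm)
    · by_contra hc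
      exact hne (eq_of_mem_components w (hp i) (hp j)
        ⟨hlt.trans hv.1, (not_lt.1 hc).trans_lt hu.2⟩ hv)

/-- A set of reals of positive measure in `(0,1)` can be cut from left to right into any number of
pieces of positive measure. -/
theorem exists_ordered_pieces {C : Set ℝ} (hC : MeasurableSet C) (h01 : C ⊆ Set.Ioo 0 1)
    (hpos : 0 < volume C) (n : ℕ) :
    ∃ A : Fin n → Set ℝ, (∀ i, A i ⊆ C) ∧ (∀ i, 0 < volume (A i)) ∧
      ∀ i j, i < j → ∀ u ∈ A i, ∀ v ∈ A j, u < v := by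
  have hfin : volume C ≠ ⊤ := ne_top_of_le_ne_top (by simp) (measure_mono h01)
  have hfin' : ∀ s : Set ℝ, volume (C ∩ s) ≠ ⊤ := fun s =>
    ne_top_of_le_ne_top hfin (measure_mono Set.inter_subset_left)
  -- The cuts are the quantiles of `C`, which exist because its distribution function is continuous.
  let F : ℝ → ℝ := fun t => volume.real (C ∩ Set.Iic t)
  have hmono : Monotone F := fun s t hst =>
    measureReal_mono (Set.inter_subset_inter_right _ (Set.Iic_subset_Iic.2 hst)) (hfin' _)
  have hsub : ∀ s t, s ≤ t → F t = F s + volume.real (C ∩ Set.Ioc s t) := by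
    intro s t hst
    rw [← measureReal_union _ (hC.inter measurableSet_Ioc) (hfin' _) (hfin' _),
      ← Set.inter_union_distrib_left, Set.Iic_union_Ioc_eq_Iic hst]
    exact (Set.Iic_disjoint_Ioc le_rfl).mono Set.inter_subset_right Set.inter_subset_right
  have hlip : ∀ s t, s ≤ t → F t ≤ F s + (t - s) := by
    intro s t hst
    rw [hsub s t hst]
    gcongr
    refine (measureReal_mono Set.inter_subset_right (by simp)).trans_eq ?_
    rw [Real.volume_real_Ioc_of_le hst]
  have hcont : Continuous F := by
    refine (LipschitzWith.of_le_add_mul 1 fun s t => ?_).continuous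
    rw [NNReal.coe_one, one_mul, Real.dist_eq]
    rcases le_total s t with h | h
    · exact (hmono h).trans (le_add_of_nonneg_right (abs_nonneg _))
    · exact (hlip t s h).trans (by gcongr; exact le_abs_self _)
  have h0 : F 0 = 0 := by
    have : C ∩ Set.Iic 0 = ∅ := by
      ext x
      simpa using fun hx => (h01 hx).1
    simp [F, this]
  have h1 : F 1 = volume.real C := by
    have : C ∩ Set.Iic 1 = C := Set.inter_eq_left.2 fun x hx => (h01 hx).2.le
    simp [F, this]
  have hc : 0 < volume.real C := ENNReal.toReal_pos hpos.ne' hfin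
  have hcut : ∀ i : ℕ, ∃ t : ℝ, i ≤ n → F t = volume.real C * (i / n) := by
    intro i
    by_cases hi : i ≤ n
    · have hin : (i : ℝ) / n ≤ 1 := div_le_one_of_le₀ (by exact_mod_cast hi) (by positivity)
      obtain ⟨t, _, ht⟩ := intermediate_value_Icc (zero_le_one (α := ℝ)) hcont.continuousOn
        (show volume.real C * (i / n) ∈ Set.Icc (F 0) (F 1) from
          ⟨by rw [h0]; positivity, by rw [h1]; exact mul_le_of_le_one_right hc.le hin⟩)
      exact ⟨t, fun _ => ht⟩
    · exact ⟨0, fun h => absurd h hi⟩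
  choose t ht using hcut
  have htlt : ∀ i j : ℕ, i < j → j ≤ n → F (t i) < F (t j) := by
    intro i j hij hj
    have hn : (0 : ℝ) < n := by exact_mod_cast (by omega : 0 < n)
    rw [ht i (by omega), ht j hj]
    gcongr
  have htle : ∀ i j : ℕ, i ≤ j → j ≤ n → t i ≤ t j := by
    intro i j hij hj
    rcases hij.eq_or_lt with rfl | hij
    · exact le_rfl
    · exact (hmono.reflect_lt (htlt i j hij hj)).le
  refine ⟨fun i => C ∩ Set.Ioc (t i) (t (i + 1)), fun i => Set.inter_subset_left, fun i => ?_, ?_⟩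
  · have h2 := htlt i (i + 1) (by omega) (by omega)
    rw [hsub _ _ (htle i (i + 1) (by omega) (by omega))] at h2
    exact pos_of_ne_zero fun h => by simp [Measure.real, h] at h2
  · intro i j hij u hu v hv
    exact (hu.2.2.trans (htle (i + 1) j (by omega) (by omega))).trans_lt hv.2.1

theorem phi_pos_of_volume_ne_one (h : volume w.pos + volume w.neg ≠ 1) (a : List Bool) :
    0 < w.phi (.ofWord a) := by
  let C := Set.Ioo (0 : ℝ) 1 \ (w.pos ∪ w.neg)
  have hm : MeasurableSet (w.pos ∪ w.neg) := (w.isOpen_pos.union w.isOpen_neg).measurableSet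
  have hC : 0 < volume C := by
    rw [pos_iff_ne_zero]
    intro h0
    apply h
    rw [← measure_union w.disjoint w.isOpen_neg.measurableSet]
    have := measure_inter_add_sdiff (μ := volume) (Set.Ioo (0 : ℝ) 1) hm
    rw [Set.inter_eq_right.2 (Set.union_subset w.pos_subset w.neg_subset)] at this
    simpa [C, h0] using this
  have hpos : ∀ u ∈ C, ∀ v, ¬ SameInterval w.pos u v := by
    rintro u hu v ⟨p, hp, hpu, _⟩
    exact hu.2 (.inl (hp.2.1 hpu))
  have hneg : ∀ u ∈ C, ∀ v, ¬ SameInterval w.neg u v := by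
    rintro u hu v ⟨p, hp, hpu, _⟩
    exact hu.2 (.inr (hp.2.1 hpu))
  obtain ⟨A, hAC, hA, hlt⟩ := exists_ordered_pieces (measurableSet_Ioo.diff hm)
    Set.sdiff_subset hC (a.length + 1)
  exact phi_pos_of_blocks A (fun i => (hAC i).trans Set.sdiff_subset) hA
    fun i j hij u hu v hv =>
      ⟨hpos u (hAC i hu) v, hneg u (hAC i hu) v, hlt i j hij u hu v hv⟩

theorem support_phi_of_not_isFinitary (h : ¬ w.IsFinitary) : support w.phi = Set.univ := by
  refine Set.eq_univ_of_forall fun x => ?_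
  cases x with
  | empty => simp [support, phi]
  | ofWord a =>
    by_cases hinf : (components w.pos ∪ components w.neg).Infinite
    · exact phi_pos_of_infinite_components hinf a
    · rw [Set.not_infinite, Set.finite_union] at hinf
      exact phi_pos_of_volume_ne_one (fun hv => h ⟨hinf.1, hinf.2, hv⟩) a

end OrientedPaintbox

end ZigzagGraph

theorem proposition3 (w : ZigzagGraph.OrientedPaintbox) :
    (∀ h : w.IsFinitary,
      ZigzagGraph.support w.phi = (ZigzagGraph.OrientedPaintbox.template h).coideal) ∧
    (¬ w.IsFinitary → ZigzagGraph.support w.phi = Set.univ) :=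
  ⟨fun h => ZigzagGraph.OrientedPaintbox.support_phi_of_isFinitary h,
    fun h => ZigzagGraph.OrientedPaintbox.support_phi_of_not_isFinitary h⟩
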